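/- Let $\lambda,\mu>0$, $\rho=\lambda/\mu$, $s\in(0,1)$ with $\rho<s$, and let $(S_N)$ be a sequence of non-negative integers with $\lim_{N\to\infty}S_N/N=s$. For each $N$ consider the following polling system with $N$ queues and $S_N$ servers. Customers arrive at each queue according to independent Poisson processes of intensity $\lambda$; service times are independent and exponential with rate $\mu$; each queue can be served by at most one server at a time. After each service, the server is instantaneously assigned to a queue chosen uniformly at random among the non-empty queues at which no server is present (the queue just left included, if it is still non-empty); if there is no such queue, the server becomes idle. When a customer arrives at an empty queue while some server is idle, an idle server moves instantaneously to this queue. Let $Q_n(t)$ be the number of customers in queue $n$ at time $t$ (the one in service included), let $I_n(t)\in\{0,1\}$ indicate the presence of a server at queue $n$, and let $X(t)=(Q_n(t),I_n(t))_{1\le n\le N}$, $t\ge 0$, be the corresponding right-continuous Markov jump process. It takes values in the set of configurations such that $I_n=1$ implies $Q_n>0$ and such that no server is idle while a non-empty queue has no server, i.e. $\sum_n I_n=\min(S_N,\#\{n:Q_n>0\})$. Suppose that for each $N$ the initial queue lengths $Q_1(0),\dots,Q_N(0)$ are independent with the geometric distribution $\mathbb P(Q_n(0)=k)=(1-\rho)\rho^k$,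 $k\ge 0$. Then for each $T\ge 0$ there exists $\varepsilon>0$ such that \[ \lim_{N\to\infty}\mathbb P\Bigl(\sup_{0\le t\le T}\ \sum_{n=1}^N \mathbf 1_{\{Q_n(t)>0\}}<S_N-\varepsilon N\Bigr)=1 . \] -/

import Mathlib

open MeasureTheory ProbabilityTheory Filter Topology
open scoped NNReal ENNReal BoundedContinuousFunction

/-- A configuration of `N` queues: the pair `(x n).1`, `(x n).2` gives the number of customers in
queue `n` (the one in service included) and whether a server is present at queue `n`. -/
abbrev PollingState (N : ℕ) : Type := Fin N → ℕ × Bool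

namespace PollingState

variable {N : ℕ}

/-- The number of non-empty queues. -/
def numNonempty (x : PollingState N) : ℕ :=
  (Finset.univ.filter fun n => 0 < (x n).1).card

/-- The number of servers that are present at some queue. -/
def numBusy (x : PollingState N) : ℕ :=
  (Finset.univ.filter fun n => (x n).2 = true).card

/-- The non-empty queues at which there is no server. -/
def waiting (x : PollingState N) : Finset (Fin N) :=
  Finset.univ.filter fun n => 0 < (x n).1 ∧ (x n).2 = false

/-- The state space with `S` servers: servers are present only at non-empty queues (at most one
at each), and, since moves are instantaneous, no server is idle while a non-empty queue has no
server. -/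
def stateSpace (S N : ℕ) : Set (PollingState N) :=
  {x | (∀ n, (x n).2 = true → 0 < (x n).1) ∧ x.numBusy = min S x.numNonempty}

/-- A customer arrives at queue `n`; if the queue has no server and one of the `S` servers is
idle, then such a server moves to queue `n` at once. -/
def arrive (S : ℕ) (x : PollingState N) (n : Fin N) : PollingState N :=
  Function.update x n ((x n).1 + 1, (x n).2 || decide (x.numBusy < S))

/-- A service is completed at queue `n`: the customer and the server leave queue `n`. -/
def depart (x : PollingState N) (n : Fin N) : PollingState N :=
  Function.update x n ((x n).1 - 1, false)

/-- A free server moves to queue `m`. -/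
def assign (x : PollingState N) (m : Fin N) : PollingState N :=
  Function.update x m ((x m).1, true)

/-- The mean of `f` over the next position of a server that has just been freed: it moves to a
queue chosen uniformly among the non-empty queues without a server, and becomes idle if there is
no such queue. -/
noncomputable def meanAssign (f : PollingState N → ℝ) (x : PollingState N) : ℝ :=
  if x.waiting = ∅ then f x
  else (∑ m ∈ x.waiting, f (x.assign m)) / (x.waiting.card : ℝ)

/-- The generator acting on functions: in each queue customers arrive at rate `lam`, and at each queue where a server
is present a service is completed at rate `mu`, after which the server chooses its next queue. -/
noncomputable def generatorFun (lam mu : ℝ) (S : ℕ) (f : PollingState N → ℝ)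
    (x : PollingState N) : ℝ :=
  ∑ n, lam * (f (x.arrive S n) - f x)
    + ∑ n, if (x n).2 = true then mu * (meanAssign f (x.depart n) - f x) else 0

theorem meanAssign_add (f g : PollingState N → ℝ) (x : PollingState N) :
    meanAssign (fun y => f y + g y) x = meanAssign f x + meanAssign g x := by
  unfold meanAssign
  split_ifs
  · rfl
  · rw [Finset.sum_add_distrib, add_div]

theorem meanAssign_smul (c : ℝ) (f : PollingState N → ℝ) (x : PollingState N) :
    meanAssign (fun y => c * f y) x = c * meanAssign f x := by
  unfold meanAssign
  split_ifs
  · rfl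
  · rw [← Finset.mul_sum, mul_div_assoc]

theorem generatorFun_add (lam mu : ℝ) (S : ℕ) (f g : PollingState N → ℝ) (x : PollingState N) :
    generatorFun lam mu S (fun y => f y + g y) x = generatorFun lam mu S f x + generatorFun lam mu S g x := by
  simp only [generatorFun, meanAssign_add]
  rw [add_add_add_comm]
  refine congrArg₂ (· + ·) (Eq.trans ?_ Finset.sum_add_distrib)
    (Eq.trans ?_ Finset.sum_add_distrib)
  · exact Finset.sum_congr rfl fun n _ => by ring
  · refine Finset.sum_congr rfl fun n _ => ?_
    split_ifs <;> ring

theorem generatorFun_smul (lam mu : ℝ) (S : ℕ) (c : ℝ) (f : PollingState N → ℝ)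
    (x : PollingState N) :
    generatorFun lam mu S (fun y => c * f y) x = c * generatorFun lam mu S f x := by
  simp only [generatorFun, meanAssign_smul]
  rw [mul_add, Finset.mul_sum, Finset.mul_sum]
  congr 1
  · exact Finset.sum_congr rfl fun n _ => by ring
  · refine Finset.sum_congr rfl fun n _ => ?_
    split_ifs <;> ring

theorem abs_meanAssign_le {f : PollingState N → ℝ} {C : ℝ} (hf : ∀ y, |f y| ≤ C)
    (x : PollingState N) : |meanAssign f x| ≤ C := by
  unfold meanAssign
  split_ifs with h
  · exact hf x
  · have hpos : (0 : ℝ) < x.waiting.card := by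
      exact_mod_cast Finset.card_pos.2 (Finset.nonempty_iff_ne_empty.2 h)
    rw [abs_div, abs_of_pos hpos, div_le_iff₀ hpos]
    refine (Finset.abs_sum_le_sum_abs _ _).trans ((Finset.sum_le_sum fun m _ => hf _).trans ?_)
    rw [Finset.sum_const, nsmul_eq_mul, mul_comm]

theorem abs_generatorFun_le (lam mu : ℝ) (S : ℕ) {f : PollingState N → ℝ} {C : ℝ}
    (hf : ∀ y, |f y| ≤ C) (x : PollingState N) :
    |generatorFun lam mu S f x| ≤ (N * (2 * |lam|) + N * (2 * |mu|)) * C := by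
  have hC : 0 ≤ C := (abs_nonneg _).trans (hf x)
  have key : ∀ a b c : ℝ, |a| ≤ C → |b| ≤ C → |c * (a - b)| ≤ 2 * |c| * C := by
    intro a b c ha hb
    rw [abs_mul]
    have : |a - b| ≤ C + C := (abs_sub a b).trans (add_le_add ha hb)
    nlinarith [abs_nonneg c, mul_le_mul_of_nonneg_left this (abs_nonneg c)]
  unfold generatorFun
  rw [add_mul]
  refine (abs_add_le _ _).trans (add_le_add ?_ ?_)
  · refine (Finset.abs_sum_le_sum_abs _ _).trans
      ((Finset.sum_le_sum fun n _ => key _ _ lam (hf _) (hf x)).trans ?_)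
    simp [mul_assoc]
  · refine (Finset.abs_sum_le_sum_abs _ _).trans
      ((Finset.sum_le_sum (g := fun _ => 2 * |mu| * C) fun n _ => ?_).trans ?_)
    · split_ifs
      · exact key _ _ mu (abs_meanAssign_le hf _) (hf x)
      · rw [abs_zero]; positivity
    · simp [mul_assoc]

/-- The generator of the polling system, as a bounded operator on the bounded functions (every
function on the discrete space of configurations is continuous). -/
noncomputable def generator (lam mu : ℝ) (S N : ℕ) :
    (PollingState N →ᵇ ℝ) →L[ℝ] (PollingState N →ᵇ ℝ) :=
  LinearMap.mkContinuous
    { toFun := fun f => BoundedContinuousFunction.ofNormedAddCommGroupDiscrete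
        (generatorFun lam mu S f) ((N * (2 * |lam|) + N * (2 * |mu|)) * ‖f‖)
        (abs_generatorFun_le lam mu S f.norm_coe_le_norm)
      map_add' := fun f g => BoundedContinuousFunction.ext fun x => generatorFun_add lam mu S f g x
      map_smul' := fun c f => BoundedContinuousFunction.ext fun x => generatorFun_smul lam mu S c f x }
    (N * (2 * |lam|) + N * (2 * |mu|))
    (fun f => BoundedContinuousFunction.norm_ofNormedAddCommGroup_le _ (by positivity)
      (abs_generatorFun_le lam mu S f.norm_coe_le_norm))

theorem generator_apply (lam mu : ℝ) (S : ℕ) (f : PollingState N →ᵇ ℝ) (x : PollingState N) :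
    generator lam mu S N f x = generatorFun lam mu S f x := rfl

end PollingState

/-- The operator `exp (t L)`. -/
noncomputable def expSemigroup {V : Type*} [NormedAddCommGroup V] [NormedSpace ℝ V]
    (L : V →L[ℝ] V) (t : ℝ) : V →L[ℝ] V :=
  NormedSpace.exp (t • L)

/-- `X` is a right-continuous Markov process (relative to some filtration, for instance its own)
whose transition semigroup is `exp (t L)`, `L` being a bounded generator. -/
structure IsMarkovJumpProcess {E Ω : Type*} [TopologicalSpace E] [MeasurableSpace E]
    [mΩ : MeasurableSpace Ω] (L : (E →ᵇ ℝ) →L[ℝ] (E →ᵇ ℝ)) (P : Measure Ω)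
    (X : ℝ≥0 → Ω → E) : Prop where
  right_continuous : ∀ ω t, ContinuousWithinAt (fun u => X u ω) (Set.Ici t) t
  markov : ∃ ℱ : Filtration ℝ≥0 mΩ, (∀ t, Measurable[ℱ t] (X t)) ∧
    ∀ (s t : ℝ≥0) (f : E →ᵇ ℝ),
      P[fun ω => f (X (s + t) ω) | ℱ s] =ᵐ[P]
        fun ω => expSemigroup L (t : ℝ) f (X s ω)

/-- `X` is the process of a homogeneous polling system with `N` queues, `S` servers, Poisson
arrivals of rate `lam` at each queue, exponential services of rate `mu`, no switchover times, and
a uniformly random choice of the next queue after each service. -/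
structure IsPollingProcess {Ω : Type*} [MeasurableSpace Ω] (lam mu : ℝ) (S N : ℕ)
    (P : Measure Ω) (X : ℝ≥0 → Ω → PollingState N) : Prop where
  mem_stateSpace : ∀ t ω, X t ω ∈ PollingState.stateSpace S N
  isMarkov : IsMarkovJumpProcess (PollingState.generator lam mu S N) P X

/-!
As long as fewer than `S N` queues are non-empty, every non-empty queue has a server, so the queue
lengths jump like `N` independent M/M/1 queues, for which the geometric initial law is invariant.
The number of non-empty queues of such a system stays close to `N * (lam / mu)`, well below `S N`.
The proof makes this rigorous without coupling or stopping times, through a barrier function.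

Let `A` be the set of queue length vectors with at least `c = (lam / mu + δ) * N` positive entries,
where `c ≤ S N`. For the generator `L₀` of the independent M/M/1 queues, the discounted number of
visits `f` to `A` (`discountedVisits`) satisfies `f ≥ 1` on `A` and `L₀ f ≤ f`
(`queueJump_discountedVisits_le`), and by invariance its mean under the initial law is
`N * (lam + mu) + 1` times the mass of `A` (`tsum_mul_discountedVisits`). Let `F` be `min f 1` at
configurations in which exactly the non-empty queues are served, and `1` elsewhere
(`PollingState.barrier`). A configuration with `F < 1` has fewer than `c ≤ S N` non-empty queues,
all of them served, and there the generator `L` of the polling system acts as `L₀`; where `F = 1`,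
`F` is maximal. Hence `L F ≤ F` everywhere (`PollingState.generatorFun_barrier_le`), so
`exp (t L) F ≤ exp t F` by positivity of the semigroup (`expSemigroup_apply_le`), and
`exp (-t) F (X t)` is a supermartingale. The maximal inequality
(`IsMarkovJumpProcess.measure_exists_one_le_le`) bounds the probability of visiting `A` before `T`
by `exp T * (N * (lam + mu) + 1)` times the probability of starting in `A`, which is exponentially
small in `N` by Hoeffding's inequality (`measureReal_card_pos_ge_le`).
-/

/-! ### Independent M/M/1 queues -/

/-- Stepping up by one in coordinate `n`. -/
def stepUp {N : ℕ} (n : Fin N) (q : Fin N → ℕ) : Fin N → ℕ :=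
  Function.update q n (q n + 1)

/-- Stepping down by one in coordinate `n`; nothing happens if this coordinate is `0`. -/
def stepDown {N : ℕ} (n : Fin N) (q : Fin N → ℕ) : Fin N → ℕ :=
  Function.update q n (q n - 1)

theorem stepDown_stepUp {N : ℕ} (n : Fin N) (q : Fin N → ℕ) : stepDown n (stepUp n q) = q := by
  simp [stepDown, stepUp]

theorem stepDown_of_eq_zero {N : ℕ} {n : Fin N} {q : Fin N → ℕ} (h : q n = 0) :
    stepDown n q = q := by
  simp [stepDown, h]

theorem stepUp_stepDown {N : ℕ} {n : Fin N} {q : Fin N → ℕ} (h : q n ≠ 0) :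
    stepUp n (stepDown n q) = q := by
  simp [stepDown, stepUp, Nat.sub_add_cancel (Nat.pos_of_ne_zero h)]

/-- A sum over all queue length vectors, split according to whether coordinate `n` vanishes. -/
theorem tsum_eq_tsum_zero_add_tsum_stepUp {N : ℕ} (n : Fin N) (g : (Fin N → ℕ) → ℝ≥0∞) :
    ∑' q, g q = ∑' q, (if q n = 0 then g q else 0) + ∑' q, g (stepUp n q) := by
  have hinj : Function.Injective (stepUp n) :=
    Function.LeftInverse.injective (stepDown_stepUp n)
  have h1 : ∑' q, g (stepUp n q) = ∑' q, (if q n = 0 then 0 else g q) := by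
    rw [← hinj.tsum_eq (f := fun q => if q n = 0 then 0 else g q)]
    · exact tsum_congr fun q => by simp [stepUp]
    · intro q hq
      have : q n ≠ 0 := fun h => by simp [h] at hq
      exact ⟨stepDown n q, stepUp_stepDown this⟩
  rw [h1, ← ENNReal.tsum_add]
  exact tsum_congr fun q => by split_ifs <;> simp

/-- The jump operator of `N` independent M/M/1 queues, uniformized: each queue attempts arrivals
at rate `a` and departures at rate `b`, a departure from an empty queue having no effect. -/
noncomputable def queueJump {N : ℕ} (a b : ℝ≥0∞) (f : (Fin N → ℕ) → ℝ≥0∞) (q : Fin N → ℕ) :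
    ℝ≥0∞ :=
  ∑ n, (a * f (stepUp n q) + b * f (stepDown n q))

/-- A measure in detailed balance for the M/M/1 queues is invariant. -/
theorem tsum_mul_queueJump {N : ℕ} {a b : ℝ≥0∞} {w : (Fin N → ℕ) → ℝ≥0∞}
    (hw : ∀ n q, b * w (stepUp n q) = a * w q) (f : (Fin N → ℕ) → ℝ≥0∞) :
    ∑' q, w q * queueJump a b f q = N * (a + b) * ∑' q, w q * f q := by
  have hn (n : Fin N) : ∑' q, w q * (a * f (stepUp n q) + b * f (stepDown n q))
      = (a + b) * ∑' q, w q * f q := by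
    have e1 : ∑' q, w q * (b * f (stepDown n q))
        = b * ∑' q, (if q n = 0 then w q * f q else 0) + a * ∑' q, w q * f q := by
      rw [tsum_eq_tsum_zero_add_tsum_stepUp n, ← ENNReal.tsum_mul_left, ← ENNReal.tsum_mul_left]
      congr 1
      · refine tsum_congr fun q => ?_
        split_ifs with h
        · rw [stepDown_of_eq_zero h]; ring
        · simp
      · refine tsum_congr fun q => ?_
        rw [stepDown_stepUp, ← mul_assoc, mul_comm (w _), hw, mul_assoc]
    have e2 : ∑' q, w q * (a * f (stepUp n q))
        = b * ∑' q, w (stepUp n q) * f (stepUp n q) := by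
      rw [← ENNReal.tsum_mul_left]
      refine tsum_congr fun q => ?_
      rw [← mul_assoc b, hw]; ring
    simp_rw [mul_add]
    rw [ENNReal.tsum_add, e1, e2, ← add_assoc, ← mul_add,
      add_comm (∑' q, w (stepUp n q) * f (stepUp n q)),
      ← tsum_eq_tsum_zero_add_tsum_stepUp n (fun q => w q * f q)]
    ring
  unfold queueJump
  simp_rw [Finset.mul_sum]
  rw [Summable.tsum_finsetSum fun _ _ => ENNReal.summable]
  simp [hn, mul_assoc]

/-- The expected number of visits to `A` of the uniformized chain of `N` independent M/M/1 queues,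
whose transition operator is `queueJump a b / (N * (a + b))`, with a discount factor
`N * (a + b) / (N * (a + b) + 1)` for each step. The discount makes
`queueJump a b f ≤ (N * (a + b) + 1) f`, that is `L₀ f ≤ f` for the generator `L₀`. -/
noncomputable def discountedVisits {N : ℕ} (a b : ℝ≥0∞) (A : Set (Fin N → ℕ))
    (q : Fin N → ℕ) : ℝ≥0∞ :=
  ∑' k, (N * (a + b) + 1)⁻¹ ^ k * (queueJump a b)^[k] (A.indicator 1) q

theorem one_le_discountedVisits {N : ℕ} (a b : ℝ≥0∞) {A : Set (Fin N → ℕ)} {q : Fin N → ℕ}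
    (hq : q ∈ A) : 1 ≤ discountedVisits a b A q := by
  refine le_trans ?_ (ENNReal.le_tsum 0)
  simp [hq]

theorem queueJump_discountedVisits_le {N : ℕ} {a b : ℝ≥0∞} (ha : a ≠ ∞) (hb : b ≠ ∞)
    (A : Set (Fin N → ℕ)) (q : Fin N → ℕ) :
    queueJump a b (discountedVisits a b A) q
      ≤ (N * (a + b) + 1) * discountedVisits a b A q := by
  set c : ℝ≥0∞ := N * (a + b) + 1 with hc
  have hc0 : c ≠ 0 := by simp [hc]
  have hct : c ≠ ∞ := by finiteness
  have key : queueJump a b (discountedVisits a b A) q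
      = ∑' k, c⁻¹ ^ k * (queueJump a b)^[k + 1] (A.indicator 1) q := by
    simp_rw [Function.iterate_succ_apply']
    rw [queueJump]
    unfold discountedVisits
    conv_rhs => enter [1, k]; rw [queueJump]
    simp_rw [← hc, Finset.mul_sum, ← ENNReal.tsum_mul_left, ← ENNReal.tsum_add]
    rw [← Summable.tsum_finsetSum fun _ _ => ENNReal.summable]
    refine tsum_congr fun k => Finset.sum_congr rfl fun n _ => ?_
    ring
  rw [key]
  unfold discountedVisits
  rw [← hc, tsum_eq_zero_add' (f := fun k => c⁻¹ ^ k * (queueJump a b)^[k] (A.indicator 1) q)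
    ENNReal.summable, mul_add, ← ENNReal.tsum_mul_left]
  refine le_trans (le_of_eq (tsum_congr fun k => ?_)) le_add_self
  rw [pow_succ', ← mul_assoc c, ← mul_assoc c, ENNReal.mul_inv_cancel hc0 hct, one_mul]

/-- Under an invariant measure the chain visits `A` at each step with the same mass, and the
discounts sum up to `N * (a + b) + 1`. -/
theorem tsum_mul_discountedVisits {N : ℕ} {a b : ℝ≥0∞} (ha : a ≠ ∞) (hb : b ≠ ∞)
    {w : (Fin N → ℕ) → ℝ≥0∞} (hw : ∀ n q, b * w (stepUp n q) = a * w q)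
    (A : Set (Fin N → ℕ)) :
    ∑' q, w q * discountedVisits a b A q
      = (N * (a + b) + 1) * ∑' q, w q * A.indicator 1 q := by
  set d : ℝ≥0∞ := N * (a + b) with hd
  have hdt : d ≠ ∞ := by finiteness
  have hit (k : ℕ) : ∑' q, w q * (queueJump a b)^[k] (A.indicator 1) q
      = d ^ k * ∑' q, w q * A.indicator 1 q := by
    induction k with
    | zero => simp
    | succ k ih =>
      simp_rw [Function.iterate_succ_apply']
      rw [tsum_mul_queueJump hw, ih, ← hd]; ring
  unfold discountedVisits
  simp_rw [← hd, ← ENNReal.tsum_mul_left]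
  rw [ENNReal.tsum_comm]
  have hk (k : ℕ) : ∑' q, w q * ((d + 1)⁻¹ ^ k * (queueJump a b)^[k] (A.indicator 1) q)
      = ((d + 1)⁻¹ * d) ^ k * ∑' q, w q * A.indicator 1 q := by
    rw [mul_pow, mul_assoc, ← hit, ← ENNReal.tsum_mul_left]
    exact tsum_congr fun q => by ring
  simp_rw [hk]
  rw [ENNReal.tsum_mul_right, ENNReal.tsum_geometric, ENNReal.tsum_mul_left]
  congr 1
  have h1 : (1 : ℝ≥0∞) = (d + 1)⁻¹ * d + (d + 1)⁻¹ := by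
    conv_rhs => rw [← mul_one ((d + 1)⁻¹), mul_assoc, one_mul, ← mul_add]
    rw [ENNReal.inv_mul_cancel (by simp) (by finiteness)]
  have h2 : 1 - (d + 1)⁻¹ * d = (d + 1)⁻¹ := by
    refine ENNReal.sub_eq_of_eq_add_rev (ENNReal.mul_ne_top (by simp) hdt) h1
  rw [h2, inv_inv]

/-! ### Semigroups of jump processes and a maximal inequality -/

/-- The semigroup `exp (t L) = exp (-t Λ) exp (t (L + Λ))` as a series in the powers of `L + Λ`. -/
theorem hasSum_expSemigroup {V : Type*} [NormedAddCommGroup V] [NormedSpace ℝ V] [CompleteSpace V]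
    (L : V →L[ℝ] V) (Λ t : ℝ) (ℓ : V →L[ℝ] ℝ) (v : V) :
    HasSum (fun n : ℕ => Real.exp (-(t * Λ)) *
        ((n.factorial : ℝ)⁻¹ * (t ^ n * ℓ (((L + Λ • ContinuousLinearMap.id ℝ V) ^ n) v))))
      (ℓ (expSemigroup L t v)) := by
  set B : V →L[ℝ] V := L + Λ • ContinuousLinearMap.id ℝ V with hB
  have hexp : expSemigroup L t = Real.exp (-(t * Λ)) • NormedSpace.exp (t • B) := by
    have e : t • L = t • B + algebraMap ℝ _ (-(t * Λ)) := by
      ext x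
      simp [hB, Algebra.algebraMap_eq_smul_one, smul_smul]
    have hcomm : Commute (t • B) (algebraMap ℝ _ (-(t * Λ))) :=
      (Algebra.commutes _ _).symm
    let _ : NormedAlgebra ℚ (V →L[ℝ] V) := NormedAlgebra.restrictScalars ℚ ℝ _
    rw [expSemigroup, e, NormedSpace.exp_add_of_commute hcomm, ← NormedSpace.algebraMap_exp_comm,
      ← Real.exp_eq_exp_ℝ, Algebra.algebraMap_eq_smul_one, mul_smul_comm, mul_one]
  have hser : HasSum (fun n : ℕ => ℓ (((n.factorial : ℝ)⁻¹ • (t • B) ^ n) v))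
      (ℓ (NormedSpace.exp (t • B) v)) :=
    (NormedSpace.exp_series_hasSum_exp' (𝕂 := ℝ) (t • B)).mapL
      (ℓ.comp (ContinuousLinearMap.apply ℝ V v))
  rw [hexp, smul_apply, map_smul, smul_eq_mul]
  refine (hser.mul_left (Real.exp (-(t * Λ)))).congr_fun fun n => ?_
  rw [smul_pow, smul_apply, smul_apply, map_smul, map_smul, smul_eq_mul, smul_eq_mul]

/-- If `L + Λ` is a positive operator and `L F ≤ F`, then `exp (t L) F ≤ exp t F`: the powers of
`L + Λ` satisfy `(L + Λ) ^ n F ≤ (1 + Λ) ^ n F`. -/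
theorem expSemigroup_apply_le {E : Type*} [TopologicalSpace E]
    (L : (E →ᵇ ℝ) →L[ℝ] (E →ᵇ ℝ)) {Λ : ℝ}
    (hpos : ∀ g : E →ᵇ ℝ, (∀ x, 0 ≤ g x) → ∀ x, 0 ≤ L g x + Λ * g x)
    {F : E →ᵇ ℝ} (hF : ∀ x, L F x ≤ F x) (hΛ : 0 ≤ Λ) {t : ℝ} (ht : 0 ≤ t) (x : E) :
    expSemigroup L t F x ≤ Real.exp t * F x := by
  set B : (E →ᵇ ℝ) →L[ℝ] (E →ᵇ ℝ) := L + Λ • ContinuousLinearMap.id ℝ _ with hB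
  have hBapp (g : E →ᵇ ℝ) (x : E) : B g x = L g x + Λ * g x := rfl
  have hpow (n : ℕ) : ∀ x, (B ^ n) F x ≤ (1 + Λ) ^ n * F x := by
    induction n with
    | zero => simp
    | succ n ih =>
      intro x
      have h1 := hpos ((1 + Λ) ^ n • F - (B ^ n) F) (fun x => by simpa using ih x) x
      rw [← hBapp, map_sub, map_smul] at h1
      have h2 : B F x ≤ (1 + Λ) * F x := by rw [hBapp]; linarith [hF x]
      have h3 := mul_le_mul_of_nonneg_left h2 (pow_nonneg (by linarith : 0 ≤ 1 + Λ) n)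
      simp only [BoundedContinuousFunction.coe_sub, BoundedContinuousFunction.coe_smul,
        Pi.sub_apply, smul_eq_mul] at h1
      rw [pow_succ' B]
      change B ((B ^ n) F) x ≤ _
      calc _ ≤ (1 + Λ) ^ n * B F x := by linarith
        _ ≤ _ := h3
        _ = _ := by ring
  have hser : HasSum (fun n : ℕ => Real.exp (-(t * Λ)) *
      ((n.factorial : ℝ)⁻¹ * (t ^ n * (B ^ n) F x))) (expSemigroup L t F x) :=
    hasSum_expSemigroup L Λ t (BoundedContinuousFunction.evalCLM ℝ x) F
  have hser2 : HasSum (fun n : ℕ => Real.exp (-(t * Λ)) *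
      (((n.factorial : ℝ)⁻¹ * (t * (1 + Λ)) ^ n) * F x)) (Real.exp t * F x) := by
    have h := ((NormedSpace.exp_series_hasSum_exp' (𝕂 := ℝ) (t * (1 + Λ))).mul_right (F x)).mul_left
      (Real.exp (-(t * Λ)))
    rw [← Real.exp_eq_exp_ℝ, ← mul_assoc, ← Real.exp_add] at h
    rwa [show -(t * Λ) + t * (1 + Λ) = t by ring] at h
  refine hasSum_le (fun n => ?_) hser hser2
  rw [mul_pow, mul_assoc _ (_ * _) (F x), mul_assoc (t ^ n)]
  gcongr
  exact hpow n x

namespace IsMarkovJumpProcess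

variable {E Ω : Type*} [TopologicalSpace E] [MeasurableSpace E] [OpensMeasurableSpace E]
  [mΩ : MeasurableSpace Ω] {L : (E →ᵇ ℝ) →L[ℝ] (E →ᵇ ℝ)} {P : Measure Ω} [IsProbabilityMeasure P]
  {X : ℝ≥0 → Ω → E}

/-- Maximal inequality along a grid: with `H` the event that `F (X ·)` reaches `1` before step `n`,
`P H + 𝔼[F (X (n h)); Hᶜ]` grows at most by the factor `exp h` when `n` increases by one. The event
of reaching `1` up to and including step `n` is bounded by the same quantity. -/
theorem measureReal_hit_add_setIntegral_le (hX : IsMarkovJumpProcess L P X) {F : E →ᵇ ℝ}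
    (hF0 : ∀ x, 0 ≤ F x)
    (hF : ∀ t : ℝ, 0 ≤ t → ∀ x, expSemigroup L t F x ≤ Real.exp t * F x) (h : ℝ≥0) (n : ℕ) :
    P.real {ω | ∃ k : ℕ, k < n ∧ 1 ≤ F (X (k * h) ω)}
        + ∫ ω in {ω | ∃ k : ℕ, k < n ∧ 1 ≤ F (X (k * h) ω)}ᶜ, F (X (n * h) ω) ∂P
      ≤ Real.exp (n * h) * ∫ ω, F (X 0 ω) ∂P ∧
    P.real {ω | ∃ k : ℕ, k < n + 1 ∧ 1 ≤ F (X (k * h) ω)}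
      ≤ Real.exp (n * h) * ∫ ω, F (X 0 ω) ∂P := by
  obtain ⟨ℱ, hadapt, hmark⟩ := hX.markov
  have hFm (t : ℝ≥0) : Measurable[ℱ t] fun ω => F (X t ω) :=
    F.continuous.measurable.comp (hadapt t)
  have hint (t : ℝ≥0) : Integrable (fun ω => F (X t ω)) P := by
    refine Integrable.of_bound ((hFm t).mono (ℱ.le t) le_rfl).aestronglyMeasurable ‖F‖ ?_
    exact ae_of_all _ fun ω => F.norm_coe_le_norm _
  set H : ℕ → Set Ω := fun n => {ω | ∃ k : ℕ, k < n ∧ 1 ≤ F (X (k * h) ω)} with hH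
  have hHm (n : ℕ) : MeasurableSet[ℱ (n * h)] (H (n + 1)) := by
    have : H (n + 1) = ⋃ k ∈ Finset.range (n + 1), {ω | 1 ≤ F (X (k * h) ω)} := by
      ext ω; simp [hH]
    rw [this]
    refine Finset.measurableSet_biUnion _ fun k hk => ?_
    have hkn : (k : ℝ≥0) * h ≤ n * h := by
      gcongr
      exact Nat.lt_succ_iff.1 (Finset.mem_range.1 hk)
    exact ℱ.mono hkn _ (hFm _ measurableSet_Ici)
  have hHm' (n : ℕ) : MeasurableSet (H n) := by
    cases n with
    | zero => simp [hH]
    | succ n => exact ℱ.le _ _ (hHm n)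
  have hHsub (n : ℕ) : H n ⊆ H (n + 1) := fun ω ⟨k, hk, hk'⟩ => ⟨k, hk.trans n.lt_succ_self, hk'⟩
  -- on the part of `H (n + 1)` outside `H n`, the value `F (X (n h))` is at least `1`
  have hsplit (n : ℕ) : P.real (H (n + 1)) + ∫ ω in (H (n + 1))ᶜ, F (X (n * h) ω) ∂P
      ≤ P.real (H n) + ∫ ω in (H n)ᶜ, F (X (n * h) ω) ∂P := by
    have e1 : (H n)ᶜ = (H (n + 1))ᶜ ∪ (H (n + 1) \ H n) := by
      ext ω
      have := @hHsub n ω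
      simp only [Set.mem_compl_iff, Set.mem_union, Set.mem_sdiff]
      tauto
    have hd : Disjoint (H (n + 1))ᶜ (H (n + 1) \ H n) :=
      Set.disjoint_left.2 fun ω h1 h2 => h1 h2.1
    have hdm := (hHm' (n + 1)).diff (hHm' n)
    have e2 : P.real (H (n + 1)) = P.real (H n) + P.real (H (n + 1) \ H n) := by
      rw [measureReal_sdiff (hHsub n) (hHm' n)]; ring
    have e3 : P.real (H (n + 1) \ H n) ≤ ∫ ω in H (n + 1) \ H n, F (X (n * h) ω) ∂P := by
      rw [← mul_one (P.real _), mul_comm]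
      refine setIntegral_ge_of_const_le_real hdm (measure_ne_top _ _) ?_ (hint _).integrableOn
      rintro ω ⟨⟨k, hk, hk'⟩, hnot⟩
      rcases Nat.lt_succ_iff_lt_or_eq.1 hk with hlt | rfl
      · exact absurd ⟨k, hlt, hk'⟩ hnot
      · exact hk'
    rw [e1, setIntegral_union hd hdm (hint _).integrableOn (hint _).integrableOn, e2]
    linarith
  have hstep (n : ℕ) : ∫ ω in (H (n + 1))ᶜ, F (X ((n + 1 : ℕ) * h) ω) ∂P
      ≤ Real.exp h * ∫ ω in (H (n + 1))ᶜ, F (X (n * h) ω) ∂P := by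
    have e : ((n + 1 : ℕ) : ℝ≥0) * h = n * h + h := by push_cast; ring
    rw [e, ← setIntegral_condExp (ℱ.le (n * h)) (hint (n * h + h)) (hHm n).compl,
      ← integral_const_mul]
    refine integral_mono_ae integrable_condExp.integrableOn
      ((hint _).const_mul _).integrableOn (ae_restrict_of_ae ?_)
    filter_upwards [hmark (n * h) h F] with ω hω
    rw [hω]
    exact hF _ h.2 _
  have hmain (n : ℕ) : P.real (H n) + ∫ ω in (H n)ᶜ, F (X (n * h) ω) ∂P
      ≤ Real.exp (n * h) * ∫ ω, F (X 0 ω) ∂P := by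
    induction n with
    | zero => simp [hH]
    | succ n ih =>
      have h1 : (1 : ℝ) ≤ Real.exp h := Real.one_le_exp h.2
      have h2 : P.real (H (n + 1)) ≤ Real.exp h * P.real (H (n + 1)) :=
        le_mul_of_one_le_left measureReal_nonneg h1
      have h3 : Real.exp ((n + 1 : ℕ) * h) = Real.exp h * Real.exp (n * h) := by
        rw [← Real.exp_add]; push_cast; ring_nf
      rw [h3, mul_assoc]
      calc _ ≤ Real.exp h * (P.real (H (n + 1)) + ∫ ω in (H (n + 1))ᶜ, F (X (n * h) ω) ∂P) := by
            linarith [hstep n]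
        _ ≤ _ := mul_le_mul_of_nonneg_left ((hsplit n).trans ih) (by positivity)
  refine ⟨hmain n, ?_⟩
  have : 0 ≤ ∫ ω in (H (n + 1))ᶜ, F (X (n * h) ω) ∂P := integral_nonneg fun ω => hF0 _
  linarith [hsplit n, hmain n]

/-- Maximal inequality: if `exp (-t) F (X t)` is a nonnegative supermartingale, then `F (X ·)`
reaches `1` up to time `T` with probability at most `exp T 𝔼[F (X 0)]`. In a discrete space the
right-continuous paths are right-constant, so that dyadic times suffice. -/
theorem measure_exists_one_le_le [DiscreteTopology E] (hX : IsMarkovJumpProcess L P X)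
    {F : E →ᵇ ℝ} (hF0 : ∀ x, 0 ≤ F x)
    (hF : ∀ t : ℝ, 0 ≤ t → ∀ x, expSemigroup L t F x ≤ Real.exp t * F x) (T : ℝ≥0) :
    P {ω | ∃ t ≤ T, 1 ≤ F (X t ω)} ≤ ENNReal.ofReal (Real.exp T * ∫ ω, F (X 0 ω) ∂P) := by
  set G : ℕ → Set Ω := fun m => {ω | ∃ k : ℕ, k < 2 ^ m + 1 ∧ 1 ≤ F (X (k * (T / 2 ^ m)) ω)} with hG
  have hmono : Monotone G := by
    refine monotone_nat_of_le_succ fun m ω => ?_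
    rintro ⟨k, hk, hk'⟩
    refine ⟨2 * k, by rw [pow_succ]; omega, ?_⟩
    have : ((2 * k : ℕ) : ℝ≥0) * (T / 2 ^ (m + 1)) = k * (T / 2 ^ m) := by
      rw [pow_succ]; push_cast; field_simp
    rwa [this]
  have hGle (m : ℕ) : P (G m) ≤ ENNReal.ofReal (Real.exp T * ∫ ω, F (X 0 ω) ∂P) := by
    have h1 := (measureReal_hit_add_setIntegral_le hX hF0 hF (T / 2 ^ m) (2 ^ m)).2
    have h2 : ((2 ^ m : ℕ) : ℝ) * ((T / 2 ^ m : ℝ≥0) : ℝ) = T := by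
      push_cast; field_simp
    rw [h2] at h1
    rw [← ofReal_measureReal]
    exact ENNReal.ofReal_le_ofReal h1
  have hsub : {ω | ∃ t ≤ T, 1 ≤ F (X t ω)} ⊆ ⋃ m, G m := by
    rintro ω ⟨t, htT, ht⟩
    have hconst : ∀ᶠ u in 𝓝[≥] t, X u ω = X t ω :=
      (hX.right_continuous ω t) (by simp : {X t ω} ∈ 𝓝 (X t ω))
    rcases eq_or_ne T 0 with rfl | hT
    · have : t = 0 := le_antisymm htT (zero_le)
      subst this
      exact Set.mem_iUnion.2 ⟨0, 0, by simp, by simpa using ht⟩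
    have hT0 : 0 < T := pos_iff_ne_zero.2 hT
    -- the first time of the `m`-th dyadic grid that is not before `t`
    set u : ℕ → ℝ≥0 := fun m => ⌈t / T * 2 ^ m⌉₊ * (T / 2 ^ m) with hu
    have hge (m : ℕ) : t ≤ u m := by
      calc t = t / T * 2 ^ m * (T / 2 ^ m) := by field_simp
        _ ≤ u m := mul_le_mul_of_nonneg_right (Nat.le_ceil _) (zero_le)
    have hle (m : ℕ) : u m ≤ t + T * (1 / 2) ^ m := by
      calc u m ≤ (t / T * 2 ^ m + 1) * (T / 2 ^ m) :=
            mul_le_mul_of_nonneg_right (Nat.ceil_lt_add_one (zero_le)).le (zero_le)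
        _ = t + T * (1 / 2) ^ m := by rw [one_div, inv_pow]; field_simp
    have hlim : Tendsto u atTop (𝓝 t) := by
      refine tendsto_of_tendsto_of_tendsto_of_le_of_le tendsto_const_nhds ?_ hge hle
      have h0 : Tendsto (fun m : ℕ => (1 / 2 : ℝ≥0) ^ m) atTop (𝓝 0) :=
        NNReal.tendsto_pow_atTop_nhds_zero_of_lt_one (by
          rw [← NNReal.coe_lt_coe]; push_cast; norm_num)
      simpa using (h0.const_mul T).const_add t
    have hlim' : Tendsto u atTop (𝓝[≥] t) :=
      tendsto_nhdsWithin_iff.2 ⟨hlim, Eventually.of_forall hge⟩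
    obtain ⟨m, hm⟩ := (hlim'.eventually hconst).exists
    refine Set.mem_iUnion.2 ⟨m, ⌈t / T * 2 ^ m⌉₊, ?_, ?_⟩
    · refine Nat.lt_succ_of_le (Nat.ceil_le.2 ?_)
      have : t / T ≤ 1 := div_le_one_of_le₀ htT (zero_le)
      push_cast
      exact mul_le_of_le_one_left (zero_le) this
    · change 1 ≤ F (X (u m) ω)
      rwa [hm]
  calc _ ≤ P (⋃ m, G m) := measure_mono hsub
    _ = ⨆ m, P (G m) := hmono.measure_iUnion
    _ ≤ _ := iSup_le hGle

end IsMarkovJumpProcess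

/-! ### The barrier function of the polling system -/

namespace PollingState

variable {N : ℕ}

/-- The queue lengths of a configuration. -/
def queueLengths (x : PollingState N) : Fin N → ℕ := fun n => (x n).1

/-- Every non-empty queue has a server, and there is no server at an empty queue. -/
def IsFullyServed (x : PollingState N) : Prop := ∀ n, (x n).2 = true ↔ 0 < (x n).1

/-- The queue length vectors with at least `c` non-empty queues. -/
def crowded (N : ℕ) (c : ℝ) : Set (Fin N → ℕ) :=
  {q | c ≤ ((Finset.univ.filter fun n => 0 < q n).card : ℝ)}

theorem IsFullyServed.numBusy_eq {x : PollingState N} (hx : x.IsFullyServed) :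
    x.numBusy = x.numNonempty := by
  unfold numBusy numNonempty
  exact congrArg Finset.card (Finset.filter_congr fun n _ => hx n)

theorem isFullyServed_of_mem_stateSpace {S : ℕ} {x : PollingState N} (hx : x ∈ stateSpace S N)
    (h : x.numNonempty ≤ S) : x.IsFullyServed := by
  obtain ⟨h1, h2⟩ := hx
  rw [min_eq_right h] at h2
  have hsub : (Finset.univ.filter fun n => (x n).2 = true)
      ⊆ Finset.univ.filter fun n => 0 < (x n).1 := fun n hn => by
    simp only [Finset.mem_filter, Finset.mem_univ, true_and] at hn ⊢
    exact h1 n hn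
  have heq := Finset.eq_of_subset_of_card_le hsub h2.ge
  intro n
  simpa using Finset.ext_iff.1 heq n

theorem queueLengths_arrive (S : ℕ) (x : PollingState N) (n : Fin N) :
    (x.arrive S n).queueLengths = stepUp n x.queueLengths := by
  ext m
  by_cases h : m = n
  · subst h; simp [queueLengths, arrive, stepUp]
  · simp [queueLengths, arrive, stepUp, h]

theorem queueLengths_depart (x : PollingState N) (n : Fin N) :
    (x.depart n).queueLengths = stepDown n x.queueLengths := by
  ext m
  by_cases h : m = n
  · subst h; simp [queueLengths, depart, stepDown]
  · simp [queueLengths, depart, stepDown, h]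

theorem queueLengths_assign (x : PollingState N) (m : Fin N) :
    (x.assign m).queueLengths = x.queueLengths := by
  ext k
  by_cases h : k = m
  · subst h; simp [queueLengths, assign]
  · simp [queueLengths, assign, h]

theorem IsFullyServed.arrive {S : ℕ} {x : PollingState N} (hx : x.IsFullyServed)
    (h : x.numNonempty < S) (n : Fin N) : (x.arrive S n).IsFullyServed := by
  intro m
  by_cases hm : m = n
  · subst hm; simp [PollingState.arrive, hx.numBusy_eq, h]
  · simpa [PollingState.arrive, hm] using hx m

theorem IsFullyServed.mem_waiting_depart {x : PollingState N} (hx : x.IsFullyServed)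
    {n m : Fin N} (h : m ∈ (x.depart n).waiting) : m = n := by
  by_contra hm
  have h1 := (Finset.mem_filter.1 h).2
  have h2 := hx m
  simp only [PollingState.depart, Function.update_of_ne hm] at h1
  simp [h1] at h2

theorem IsFullyServed.assign_depart {x : PollingState N} (hx : x.IsFullyServed)
    {n m : Fin N} (h : m ∈ (x.depart n).waiting) : ((x.depart n).assign m).IsFullyServed := by
  obtain rfl := hx.mem_waiting_depart h
  intro k
  by_cases hk : k = m
  · subst hk
    simp only [waiting, Finset.mem_filter, Finset.mem_univ, true_and] at h
    simp [assign, h.1]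
  · simpa [assign, depart, hk] using hx k

theorem IsFullyServed.depart {x : PollingState N} (hx : x.IsFullyServed)
    {n : Fin N} (h : (x.depart n).waiting = ∅) : (x.depart n).IsFullyServed := by
  intro k
  by_cases hk : k = n
  · subst hk
    have : k ∉ (x.depart k).waiting := by simp [h]
    rw [waiting, Finset.mem_filter] at this
    simpa [PollingState.depart] using this
  · simpa [PollingState.depart, hk] using hx k

theorem meanAssign_le {f : PollingState N → ℝ} {x : PollingState N} {C : ℝ}
    (h1 : x.waiting = ∅ → f x ≤ C) (h2 : ∀ m ∈ x.waiting, f (x.assign m) ≤ C) :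
    meanAssign f x ≤ C := by
  unfold meanAssign
  split_ifs with h
  · exact h1 h
  · have hpos : (0 : ℝ) < x.waiting.card := by
      exact_mod_cast Finset.card_pos.2 (Finset.nonempty_iff_ne_empty.2 h)
    rw [div_le_iff₀ hpos, mul_comm, ← nsmul_eq_mul]
    exact Finset.sum_le_card_nsmul _ _ _ h2

theorem meanAssign_nonneg {f : PollingState N → ℝ} (hf : ∀ y, 0 ≤ f y) (x : PollingState N) :
    0 ≤ meanAssign f x := by
  unfold meanAssign
  split_ifs
  · exact hf x
  · exact div_nonneg (Finset.sum_nonneg fun m _ => hf _) (Nat.cast_nonneg _)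

theorem generatorFun_add_nonneg {lam mu : ℝ} (hlam : 0 ≤ lam) (hmu : 0 ≤ mu) (S : ℕ)
    {f : PollingState N → ℝ} (hf : ∀ y, 0 ≤ f y) (x : PollingState N) :
    0 ≤ generatorFun lam mu S f x + N * (lam + mu) * f x := by
  have e : (N : ℝ) * (lam + mu) * f x = ∑ _n : Fin N, lam * f x + ∑ _n : Fin N, mu * f x := by
    simp; ring
  rw [generatorFun, e, add_add_add_comm, ← Finset.sum_add_distrib, ← Finset.sum_add_distrib]
  refine add_nonneg (Finset.sum_nonneg fun n _ => ?_) (Finset.sum_nonneg fun n _ => ?_)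
  · linarith [mul_nonneg hlam (hf (x.arrive S n))]
  · have h1 := mul_nonneg hmu (meanAssign_nonneg hf (x.depart n))
    have h2 := mul_nonneg hmu (hf x)
    split_ifs <;> linarith

open Classical in
/-- The barrier function: `discountedVisits` truncated at `1` on the fully served configurations,
and `1` on the other ones. -/
noncomputable def barrier (lam mu c : ℝ) (x : PollingState N) : ℝ :=
  if x.IsFullyServed then
    (min (discountedVisits (ENNReal.ofReal lam) (ENNReal.ofReal mu) (crowded N c)
      x.queueLengths) 1).toReal
  else 1

theorem barrier_nonneg (lam mu c : ℝ) (x : PollingState N) : 0 ≤ barrier lam mu c x := by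
  unfold barrier
  split_ifs <;> positivity

theorem barrier_le_one (lam mu c : ℝ) (x : PollingState N) : barrier lam mu c x ≤ 1 := by
  unfold barrier
  split_ifs
  · exact ENNReal.toReal_le_of_le_ofReal zero_le_one (by simp)
  · exact le_rfl

theorem barrier_le_toReal {lam mu c : ℝ} {x : PollingState N} (hx : x.IsFullyServed)
    (h : discountedVisits (ENNReal.ofReal lam) (ENNReal.ofReal mu) (crowded N c)
      x.queueLengths ≠ ∞) :
    barrier lam mu c x ≤ (discountedVisits (ENNReal.ofReal lam) (ENNReal.ofReal mu)
      (crowded N c) x.queueLengths).toReal := by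
  rw [barrier, if_pos hx]
  exact ENNReal.toReal_mono h (min_le_left _ _)

theorem barrier_eq_one {lam mu c : ℝ} {x : PollingState N} (hx : c ≤ x.numNonempty) :
    barrier lam mu c x = 1 := by
  unfold barrier
  split_ifs
  · rw [min_eq_right (one_le_discountedVisits _ _ hx), ENNReal.toReal_one]
  · rfl

/-- On the state space the barrier is below `discountedVisits` even where queues lack a server:
by `c ≤ S` such configurations are crowded. -/
theorem ofReal_barrier_le {lam mu c : ℝ} {S : ℕ} (hc : c ≤ S) {x : PollingState N}
    (hx : x ∈ stateSpace S N) :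
    ENNReal.ofReal (barrier lam mu c x) ≤
      discountedVisits (ENNReal.ofReal lam) (ENNReal.ofReal mu) (crowded N c) x.queueLengths := by
  by_cases h : c ≤ x.numNonempty
  · rw [barrier_eq_one h, ENNReal.ofReal_one]
    exact one_le_discountedVisits _ _ h
  · have : x.numNonempty ≤ S := by
      exact_mod_cast ((not_le.1 h).le.trans hc)
    rw [barrier, if_pos (isFullyServed_of_mem_stateSpace hx this), ENNReal.ofReal_toReal (by simp)]
    exact min_le_left _ _

/-- Where the barrier is less than `1`, all queues are served and fewer than `S` servers are busy,
so that the polling system jumps as the M/M/1 queues do, and the superharmonicity of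
`discountedVisits` applies. Where the barrier is `1`, it is maximal. -/
theorem generatorFun_barrier_le {lam mu c : ℝ} (hlam : 0 < lam) (hmu : 0 < mu) {S : ℕ}
    (hc : c ≤ S) (x : PollingState N) :
    generatorFun lam mu S (barrier lam mu c) x ≤ barrier lam mu c x := by
  rcases (barrier_le_one lam mu c x).eq_or_lt with h1 | hlt
  · refine le_trans ?_ (barrier_nonneg lam mu c x)
    rw [generatorFun, h1]
    refine add_nonpos (Finset.sum_nonpos fun n _ => ?_) (Finset.sum_nonpos fun n _ => ?_)
    · exact mul_nonpos_of_nonneg_of_nonpos hlam.le (sub_nonpos.2 (barrier_le_one _ _ _ _))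
    · split_ifs
      · exact mul_nonpos_of_nonneg_of_nonpos hmu.le (sub_nonpos.2
          (meanAssign_le (fun _ => barrier_le_one _ _ _ _) fun _ _ => barrier_le_one _ _ _ _))
      · exact le_rfl
  have hx : x.IsFullyServed := by
    by_contra h
    simp [barrier, h] at hlt
  have hS : x.numNonempty < S := by
    by_contra h
    exact hlt.ne (barrier_eq_one (hc.trans (by exact_mod_cast not_lt.1 h)))
  set q := x.queueLengths with hq
  set f := discountedVisits (ENNReal.ofReal lam) (ENNReal.ofReal mu) (crowded N c) with hf
  have hf1 : f q < 1 := by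
    by_contra h
    rw [barrier, if_pos hx, min_eq_right (not_lt.1 h)] at hlt
    simp at hlt
  have hFx : barrier lam mu c x = (f q).toReal := by
    rw [barrier, if_pos hx, min_eq_left hf1.le]
  have hjump := queueJump_discountedVisits_le (ENNReal.ofReal_ne_top (r := lam))
    (ENNReal.ofReal_ne_top (r := mu)) (crowded N c) q
  rw [← hf] at hjump
  have hrhs : ((N : ℝ≥0∞) * (ENNReal.ofReal lam + ENNReal.ofReal mu) + 1) * f q ≠ ∞ :=
    ENNReal.mul_ne_top (by finiteness) (hf1.trans ENNReal.one_lt_top).ne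
  have hfin : queueJump (ENNReal.ofReal lam) (ENNReal.ofReal mu) f q ≠ ∞ :=
    ne_top_of_le_ne_top hrhs hjump
  have hterm (n : Fin N) := ENNReal.add_ne_top.1
    (ENNReal.sum_ne_top.1 hfin n (Finset.mem_univ n))
  have hup (n : Fin N) : f (stepUp n q) ≠ ∞ := fun h =>
    (hterm n).1 (by rw [h, ENNReal.mul_top (by simpa using hlam)])
  have hdown (n : Fin N) : f (stepDown n q) ≠ ∞ := fun h =>
    (hterm n).2 (by rw [h, ENNReal.mul_top (by simpa using hmu)])
  have hreal : ∑ n, (lam * (f (stepUp n q)).toReal + mu * (f (stepDown n q)).toReal)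
      ≤ (N * (lam + mu) + 1) * (f q).toReal := by
    have h := ENNReal.toReal_mono hrhs hjump
    rw [queueJump, ENNReal.toReal_sum fun n _ => ENNReal.add_ne_top.2 (hterm n),
      ENNReal.toReal_mul, ENNReal.toReal_add (by finiteness) (by simp), ENNReal.toReal_mul,
      ENNReal.toReal_add (by simp) (by simp), ENNReal.toReal_ofReal hlam.le,
      ENNReal.toReal_ofReal hmu.le, ENNReal.toReal_natCast, ENNReal.toReal_one] at h
    refine le_trans (le_of_eq (Finset.sum_congr rfl fun n _ => ?_)) h
    rw [ENNReal.toReal_add (hterm n).1 (hterm n).2, ENNReal.toReal_mul, ENNReal.toReal_mul,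
      ENNReal.toReal_ofReal hlam.le, ENNReal.toReal_ofReal hmu.le]
  have harr (n : Fin N) : lam * (barrier lam mu c (x.arrive S n) - barrier lam mu c x)
      ≤ lam * ((f (stepUp n q)).toReal - (f q).toReal) := by
    rw [hFx, hq, ← queueLengths_arrive S]
    gcongr
    refine barrier_le_toReal (hx.arrive hS n) ?_
    rw [queueLengths_arrive]
    exact hup n
  have hdep (n : Fin N) : (if (x n).2 = true then
        mu * (meanAssign (barrier lam mu c) (x.depart n) - barrier lam mu c x) else 0)
      ≤ mu * ((f (stepDown n q)).toReal - (f q).toReal) := by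
    split_ifs with hn
    · rw [hFx]
      gcongr
      refine meanAssign_le (fun h => ?_) fun m hm => ?_
      · rw [hq, ← queueLengths_depart]
        refine barrier_le_toReal (hx.depart h) ?_
        rw [queueLengths_depart]
        exact hdown n
      · rw [hq, ← queueLengths_depart, ← queueLengths_assign _ m]
        refine barrier_le_toReal (hx.assign_depart hm) ?_
        rw [queueLengths_assign, queueLengths_depart]
        exact hdown n
    · have h0 : q n = 0 := by
        have := hx n
        simp only [hn] at this
        simpa [hq, queueLengths] using this
      rw [stepDown_of_eq_zero h0]
      simp
  rw [generatorFun]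
  calc _ ≤ ∑ n, lam * ((f (stepUp n q)).toReal - (f q).toReal)
        + ∑ n, mu * ((f (stepDown n q)).toReal - (f q).toReal) :=
        add_le_add (Finset.sum_le_sum fun n _ => harr n) (Finset.sum_le_sum fun n _ => hdep n)
    _ = ∑ n, (lam * (f (stepUp n q)).toReal + mu * (f (stepDown n q)).toReal)
        - N * (lam + mu) * (f q).toReal := by
        simp only [mul_sub, Finset.sum_sub_distrib, Finset.sum_add_distrib, Finset.sum_const,
          Finset.card_univ, Fintype.card_fin, nsmul_eq_mul]
        ring
    _ ≤ (f q).toReal := by linarith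
    _ = _ := hFx.symm

end PollingState

/-! ### Geometric initial queue lengths -/

section Geometric

variable {Ω : Type*} [MeasurableSpace Ω] {P : Measure Ω} {N : ℕ} {Q : Fin N → Ω → ℕ}

theorem measure_eq_prod_geometric {ρ : ℝ} (hindep : iIndepFun Q P)
    (hgeom : ∀ n k, P {ω | Q n ω = k} = ENNReal.ofReal ((1 - ρ) * ρ ^ k)) (q : Fin N → ℕ) :
    P {ω | (fun n => Q n ω) = q} = ∏ n, ENNReal.ofReal ((1 - ρ) * ρ ^ q n) := by
  have h := hindep.measure_inter_preimage_eq_mul Finset.univ (sets := fun n => {q n})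
    fun _ _ => measurableSet_singleton _
  have e : {ω | (fun n => Q n ω) = q} = ⋂ n ∈ Finset.univ, Q n ⁻¹' {q n} := by
    ext ω; simp [funext_iff]
  rw [e, h]
  exact Finset.prod_congr rfl fun n _ => hgeom n (q n)

/-- Independent geometric queue lengths are in detailed balance for the M/M/1 dynamics. -/
theorem detailedBalance_geometric {lam mu : ℝ} (hlam : 0 < lam) (hmu : 0 < mu)
    (hindep : iIndepFun Q P)
    (hgeom : ∀ n k, P {ω | Q n ω = k} = ENNReal.ofReal ((1 - lam / mu) * (lam / mu) ^ k))
    (n : Fin N) (q : Fin N → ℕ) :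
    ENNReal.ofReal mu * P {ω | (fun n => Q n ω) = stepUp n q}
      = ENNReal.ofReal lam * P {ω | (fun n => Q n ω) = q} := by
  rw [measure_eq_prod_geometric hindep hgeom, measure_eq_prod_geometric hindep hgeom,
    ← Finset.mul_prod_erase _ _ (Finset.mem_univ n), ← Finset.mul_prod_erase _ _ (Finset.mem_univ n),
    ← mul_assoc, ← mul_assoc, ← ENNReal.ofReal_mul hmu.le, ← ENNReal.ofReal_mul hlam.le]
  congr 1
  · congr 1
    simp only [stepUp, Function.update_self, pow_succ]
    field_simp
  · refine Finset.prod_congr rfl fun m hm => ?_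
    rw [stepUp, Function.update_of_ne (Finset.ne_of_mem_erase hm)]

/-- Hoeffding's bound on the number of non-empty queues among independent queues, each of which is
non-empty with probability `ρ`. -/
theorem measureReal_card_pos_ge_le [IsProbabilityMeasure P] {ρ δ : ℝ} (hδ : 0 ≤ δ)
    (hQ : ∀ n, Measurable (Q n)) (hindep : iIndepFun Q P)
    (hgeom : ∀ n k, P {ω | Q n ω = k} = ENNReal.ofReal ((1 - ρ) * ρ ^ k)) (hρ : ρ ≤ 1) :
    P.real {ω | (ρ + δ) * N ≤ ((Finset.univ.filter fun n => 0 < Q n ω).card : ℝ)}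
      ≤ Real.exp (-(2 * δ ^ 2) * N) := by
  set Y : Fin N → Ω → ℝ := fun n ω => if 0 < Q n ω then 1 else 0 with hY
  have hφ : Measurable fun k : ℕ => if 0 < k then (1 : ℝ) else 0 := measurable_from_top
  have hYm (n : Fin N) : Measurable (Y n) := hφ.comp (hQ n)
  have hmean (n : Fin N) : P[Y n] = ρ := by
    have hset : {ω | 0 < Q n ω} = {ω | Q n ω = 0}ᶜ := by
      ext ω; simp [Nat.pos_iff_ne_zero]
    have h0 : MeasurableSet {ω | Q n ω = 0} := hQ n (measurableSet_singleton 0)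
    have e : Y n = {ω | 0 < Q n ω}.indicator 1 := by
      ext ω; simp [hY, Set.indicator_apply]
    rw [e, integral_indicator_one (by rw [hset]; exact h0.compl), hset, probReal_compl_eq_one_sub h0,
      measureReal_def, hgeom, ENNReal.toReal_ofReal (by simpa using hρ)]
    ring
  have hsub (n : Fin N) : HasSubgaussianMGF (fun ω => Y n ω - ρ) ((‖(1 : ℝ) - 0‖₊ / 2) ^ 2) P := by
    have h := hasSubgaussianMGF_of_mem_Icc (μ := P) (X := Y n) (a := 0) (b := 1)
      (hYm n).aemeasurable (ae_of_all _ fun ω => by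
        simp only [hY]
        split_ifs <;> simp)
    rwa [hmean n] at h
  have hind : iIndepFun (fun n ω => Y n ω - ρ) P :=
    hindep.comp (fun _ k => (if 0 < k then (1 : ℝ) else 0) - ρ) fun _ => hφ.sub_const ρ
  have hH := HasSubgaussianMGF.measure_sum_ge_le_of_iIndepFun hind (s := Finset.univ)
    (fun n _ => hsub n) (ε := δ * N) (by positivity)
  have e1 : {ω | δ * N ≤ ∑ n, (Y n ω - ρ)}
      = {ω | (ρ + δ) * N ≤ ((Finset.univ.filter fun n => 0 < Q n ω).card : ℝ)} := by
    ext ω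
    simp only [hY, Set.mem_ofPred_eq, Finset.sum_sub_distrib, Finset.sum_boole, Finset.sum_const,
      Finset.card_univ, Fintype.card_fin, nsmul_eq_mul]
    constructor <;> intro h <;> linarith
  rw [e1] at hH
  refine hH.trans (le_of_eq ?_)
  congr 1
  rcases Nat.eq_zero_or_pos N with rfl | hN
  · simp
  · have : (N : ℝ) ≠ 0 := by positivity
    simp
    field_simp

end Geometric

/-- For the polling system started with independent geometric queue lengths, the probability that
at least `c` queues are non-empty at some time before `T` is controlled by the probability of this
event at time `0`. -/
theorem IsPollingProcess.measure_exists_le_numNonempty_le {Ω : Type*} [MeasurableSpace Ω]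
    {lam mu c : ℝ} (hlam : 0 < lam) (hmu : 0 < mu) {S N : ℕ} (hc : c ≤ S) {P : Measure Ω}
    [IsProbabilityMeasure P] {X : ℝ≥0 → Ω → PollingState N}
    (hX : IsPollingProcess lam mu S N P X)
    (hindep : iIndepFun (fun (n : Fin N) (ω : Ω) => (X 0 ω n).1) P)
    (hgeom : ∀ (n : Fin N) (k : ℕ),
      P {ω | (X 0 ω n).1 = k} = ENNReal.ofReal ((1 - lam / mu) * (lam / mu) ^ k)) (T : ℝ≥0) :
    P {ω | ∃ t ≤ T, c ≤ ((X t ω).numNonempty : ℝ)}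
      ≤ ENNReal.ofReal (Real.exp T * (N * (lam + mu) + 1))
        * P {ω | c ≤ ((X 0 ω).numNonempty : ℝ)} := by
  open PollingState in
  set F : PollingState N →ᵇ ℝ := BoundedContinuousFunction.ofNormedAddCommGroupDiscrete
    (barrier lam mu c) 1 fun x => by
      rw [Real.norm_of_nonneg (barrier_nonneg _ _ _ _)]; exact barrier_le_one _ _ _ _ with hF
  have hX0 : Measurable (X 0) := by
    obtain ⟨ℱ, hadapt, -⟩ := hX.isMarkov.markov
    exact (hadapt 0).mono (ℱ.le 0) le_rfl
  have hexp (t : ℝ) (ht : 0 ≤ t) (x : PollingState N) :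
      expSemigroup (generator lam mu S N) t F x ≤ Real.exp t * F x := by
    refine expSemigroup_apply_le _ (Λ := N * (lam + mu)) (fun g hg x => ?_) (fun x => ?_)
      (by positivity) ht x
    · exact generatorFun_add_nonneg hlam.le hmu.le S hg x
    · exact generatorFun_barrier_le hlam hmu hc x
  have hmax := hX.isMarkov.measure_exists_one_le_le (F := F) (fun x => barrier_nonneg _ _ _ x)
    hexp T
  set f := discountedVisits (ENNReal.ofReal lam) (ENNReal.ofReal mu) (crowded N c) with hf
  have hq : Measurable fun ω => (X 0 ω).queueLengths :=
    (measurable_of_countable (queueLengths : PollingState N → Fin N → ℕ)).comp hX0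
  have hlaw (g : (Fin N → ℕ) → ℝ≥0∞) : ∫⁻ ω, g (X 0 ω).queueLengths ∂P
      = ∑' q, P {ω | (fun n => (X 0 ω n).1) = q} * g q := by
    rw [← lintegral_map (f := g) (measurable_of_countable g) hq, lintegral_countable']
    refine tsum_congr fun q => ?_
    rw [Measure.map_apply hq (measurableSet_singleton q), mul_comm]
    rfl
  have hint : ENNReal.ofReal (∫ ω, F (X 0 ω) ∂P)
      ≤ ENNReal.ofReal (N * (lam + mu) + 1) * P {ω | c ≤ ((X 0 ω).numNonempty : ℝ)} := by
    have hFint : Integrable (fun ω => F (X 0 ω)) P :=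
      Integrable.of_bound (F.continuous.measurable.comp hX0).aestronglyMeasurable ‖F‖
        (ae_of_all _ fun ω => F.norm_coe_le_norm _)
    rw [ofReal_integral_eq_lintegral_ofReal hFint (ae_of_all _ fun ω => barrier_nonneg _ _ _ _)]
    calc ∫⁻ ω, ENNReal.ofReal (F (X 0 ω)) ∂P ≤ ∫⁻ ω, f (X 0 ω).queueLengths ∂P :=
          lintegral_mono fun ω => ofReal_barrier_le hc (hX.mem_stateSpace 0 ω)
      _ = (N * (ENNReal.ofReal lam + ENNReal.ofReal mu) + 1)
          * ∫⁻ ω, (crowded N c).indicator 1 (X 0 ω).queueLengths ∂P := by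
          rw [hlaw, hlaw]
          exact tsum_mul_discountedVisits (by simp) (by simp)
            (detailedBalance_geometric hlam hmu hindep hgeom) _
      _ = _ := by
          congr 1
          · rw [ENNReal.ofReal_add (by positivity) zero_le_one, ENNReal.ofReal_mul (by positivity),
              ENNReal.ofReal_add hlam.le hmu.le, ENNReal.ofReal_natCast, ENNReal.ofReal_one]
          · have hm : MeasurableSet {ω | c ≤ ((X 0 ω).numNonempty : ℝ)} :=
              hq (Set.to_countable (crowded N c)).measurableSet
            rw [← lintegral_indicator_one hm]
            rfl
  refine le_trans (measure_mono ?_) (hmax.trans ?_)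
  · rintro ω ⟨t, ht, h⟩
    exact ⟨t, ht, (barrier_eq_one h).ge⟩
  · rw [ENNReal.ofReal_mul (Real.exp_pos _).le, ENNReal.ofReal_mul (Real.exp_pos _).le, mul_assoc]
    gcongr

theorem tendsto_mul_exp_neg_natCast (a b : ℝ) {κ : ℝ} (hκ : 0 < κ) :
    Tendsto (fun N : ℕ => (N * a + b) * Real.exp (-κ * N)) atTop (𝓝 0) := by
  have h (k : ℝ) := (tendsto_rpow_mul_exp_neg_mul_atTop_nhds_zero k κ hκ).comp
    tendsto_natCast_atTop_atTop
  have h01 := ((h 1).const_mul a).add ((h 0).const_mul b)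
  simp only [mul_zero, add_zero] at h01
  refine h01.congr fun N => ?_
  simp only [Function.comp_apply, Real.rpow_one, Real.rpow_zero]
  ring

theorem mainTheorem1 (lam mu s : ℝ) (hlam : 0 < lam) (hmu : 0 < mu) (hs0 : 0 < s) (hs1 : s < 1)
    (hload : lam / mu < s)
    (S : ℕ → ℕ) (hS : Tendsto (fun N : ℕ => (S N : ℝ) / (N : ℝ)) atTop (𝓝 s))
    (Ω : ℕ → Type*) [∀ N, MeasurableSpace (Ω N)]
    (P : ∀ N, Measure (Ω N)) [∀ N, IsProbabilityMeasure (P N)]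
    (X : ∀ N, ℝ≥0 → Ω N → PollingState N)
    (hX : ∀ N, IsPollingProcess lam mu (S N) N (P N) (X N))
    (hindep : ∀ N, iIndepFun (fun (n : Fin N) (ω : Ω N) => (X N 0 ω n).1) (P N))
    (hgeom : ∀ (N : ℕ) (n : Fin N) (k : ℕ),
      P N {ω | (X N 0 ω n).1 = k} = ENNReal.ofReal ((1 - lam / mu) * (lam / mu) ^ k))
    (T : ℝ≥0) :
    ∃ ε : ℝ, 0 < ε ∧
      Tendsto
        (fun N : ℕ => P N {ω | (⨆ t : Set.Icc (0 : ℝ≥0) T, ((X N t ω).numNonempty : ℝ))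
          < (S N : ℝ) - ε * (N : ℝ)})
        atTop (𝓝 1) := by
  set ρ := lam / mu with hρ
  -- `ρ + δ` is the threshold for the fraction of non-empty queues, and `S N / N` eventually
  -- exceeds `ρ + 2 * δ`
  set δ := (s - ρ) / 3 with hδ
  have hδ0 : 0 < δ := by rw [hδ]; linarith
  refine ⟨δ / 2, half_pos hδ0, ?_⟩
  have hSN : ∀ᶠ N : ℕ in atTop, 0 < N ∧ (ρ + 2 * δ) * N ≤ S N := by
    have h1 : ρ + 2 * δ < s := by rw [hδ]; linarith
    filter_upwards [hS.eventually (lt_mem_nhds h1), eventually_gt_atTop 0] with N hN hN0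
    have : (0 : ℝ) < N := by exact_mod_cast hN0
    exact ⟨hN0, ((lt_div_iff₀ this).1 hN).le⟩
  have hbound : ∀ᶠ N : ℕ in atTop, 1 - ENNReal.ofReal (Real.exp T *
      ((N * (lam + mu) + 1) * Real.exp (-(2 * δ ^ 2) * N))) ≤
      P N {ω | (⨆ t : Set.Icc (0 : ℝ≥0) T, ((X N t ω).numNonempty : ℝ))
          < (S N : ℝ) - δ / 2 * (N : ℝ)} := by
    filter_upwards [hSN] with N ⟨hN0, hN⟩
    have hN0' : (0 : ℝ) < N := by exact_mod_cast hN0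
    have hδN : 0 < δ * N := by positivity
    have hc : (ρ + δ) * N ≤ S N := by linarith
    have hX0 : Measurable (X N 0) := by
      obtain ⟨ℱ, hadapt, -⟩ := (hX N).isMarkov.markov
      exact (hadapt 0).mono (ℱ.le 0) le_rfl
    have hinit : P N {ω | (ρ + δ) * N ≤ ((X N 0 ω).numNonempty : ℝ)}
        ≤ ENNReal.ofReal (Real.exp (-(2 * δ ^ 2) * N)) := by
      rw [← ofReal_measureReal]
      exact ENNReal.ofReal_le_ofReal (measureReal_card_pos_ge_le hδ0.le
        (fun n => measurable_fst.comp ((measurable_pi_apply n).comp hX0)) (hindep N) (hgeom N)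
        (hload.trans hs1).le)
    have hhit := (hX N).measure_exists_le_numNonempty_le hlam hmu hc (hindep N) (hgeom N) T
    have hbad : P N {ω | ∃ t ≤ T, (ρ + δ) * N ≤ ((X N t ω).numNonempty : ℝ)}
        ≤ ENNReal.ofReal (Real.exp T * ((N * (lam + mu) + 1) * Real.exp (-(2 * δ ^ 2) * N))) := by
      refine hhit.trans ?_
      rw [← mul_assoc, ENNReal.ofReal_mul (p := Real.exp T * _) (by positivity)]
      gcongr
    refine le_trans (tsub_le_tsub_left hbad 1) (tsub_le_iff_left.2 ?_)
    rw [← measure_univ (μ := P N)]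
    refine le_trans (measure_mono fun ω _ => ?_) (measure_union_le _ _)
    by_cases hω : ∃ t ≤ T, (ρ + δ) * N ≤ ((X N t ω).numNonempty : ℝ)
    · exact Or.inl hω
    · right
      push Not at hω
      have : Nonempty (Set.Icc (0 : ℝ≥0) T) := ⟨⟨0, by simp⟩⟩
      have hsup : (⨆ t : Set.Icc (0 : ℝ≥0) T, ((X N t ω).numNonempty : ℝ)) ≤ (ρ + δ) * N :=
        ciSup_le fun t => (hω t t.2.2).le
      exact hsup.trans_lt (by linarith)
  refine tendsto_of_tendsto_of_tendsto_of_le_of_le' ?_ tendsto_const_nhds hbound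
    (Eventually.of_forall fun N => prob_le_one)
  have h0 := ENNReal.tendsto_ofReal ((tendsto_mul_exp_neg_natCast (lam + mu) 1
    (by positivity : 0 < 2 * δ ^ 2)).const_mul (Real.exp T))
  simpa using ENNReal.Tendsto.sub (tendsto_const_nhds (x := (1 : ℝ≥0∞))) h0 (Or.inl ENNReal.one_ne_top)
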